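/- Let $\mathbb{F}$ be a free group of finite rank $n$. A subgroup $A\le\mathbb{F}$ is a free factor if $\mathbb{F}=A*B$ for some subgroup $B\le\mathbb{F}$, called a complementary free factor; the corank of $A$ is the rank of any complementary free factor. The free factor complex $\mathcal{F}_n$ is the simplicial complex whose vertices are the conjugacy classes of nontrivial proper free factors of $\mathbb{F}$, where a nonempty finite set of vertices spans a simplex if it can be ordered as $[A_1],\dots,[A_k]$ with $A_1\subset A_2\subset\cdots\subset A_k$ up to conjugation. For a free factor $A$, let $\mathcal{F}^{\uparrow}(A)$ be the full subcomplex of $\mathcal{F}_n$ spanned by the vertices that properly contain $A$ up to conjugation. If the corank of $A$ is at least $3$, then $\mathcal{F}^{\uparrow}(A)$ is connected (in particular nonempty). -/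

import Mathlib

/-- `F = H * K`: the group `F` is the internal free product of its subgroups `H` and `K`, that is,
the canonical homomorphism from the free product `H ∗ K` to `F` is an isomorphism. -/
def IsInternalFreeProduct {F : Type*} [Group F] (H K : Subgroup F) : Prop :=
  Function.Bijective (Monoid.Coprod.lift H.subtype K.subtype)

/-- `H` is a free factor of `F` if it has a complementary free factor. The trivial subgroup and
the whole group are free factors in this sense. -/
def IsFreeFactor {F : Type*} [Group F] (H : Subgroup F) : Prop :=
  ∃ K : Subgroup F, IsInternalFreeProduct H K

/-- `A` is a free factor of corank `k`: it has a complementary free factor that is free of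
rank `k`. -/
def HasCorank {F : Type*} [Group F] (A : Subgroup F) (k : ℕ) : Prop :=
  ∃ B : Subgroup F, IsInternalFreeProduct A B ∧ Nonempty (FreeGroup (Fin k) ≃* B)

/-- Conjugacy of subgroups. -/
def subgroupConjSetoid (F : Type*) [Group F] : Setoid (Subgroup F) where
  r H K := ∃ g : F, H.map (MulAut.conj g).toMonoidHom = K
  iseqv :=
    { refl := fun H => ⟨1, by ext x; simp⟩
      symm := by
        rintro H _ ⟨g, rfl⟩
        refine ⟨g⁻¹, ?_⟩
        rw [Subgroup.map_map]
        ext x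
        simp [Subgroup.mem_map, mul_assoc]
      trans := by
        rintro H _ _ ⟨g, rfl⟩ ⟨h, rfl⟩
        refine ⟨h * g, ?_⟩
        rw [Subgroup.map_map]
        congr 1
        ext x
        simp [mul_assoc] }

/-- Conjugacy classes of subgroups of `F`. -/
def SubgroupConjClass (F : Type*) [Group F] : Type _ := Quotient (subgroupConjSetoid F)

/-- The conjugacy class of a subgroup. -/
def SubgroupConjClass.mk {F : Type*} [Group F] (H : Subgroup F) : SubgroupConjClass F :=
  Quotient.mk (subgroupConjSetoid F) H

/-- Vertices of the free factor complex: conjugacy classes of free factors of `F` that are neither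
trivial nor the whole group. -/
def FreeFactorVertex (F : Type*) [Group F] : Type _ :=
  {X : SubgroupConjClass F // ∃ H : Subgroup F,
    SubgroupConjClass.mk H = X ∧ IsFreeFactor H ∧ H ≠ ⊥ ∧ H ≠ ⊤}

/-- Inclusion up to conjugation. -/
def FreeFactorVertex.Incl {F : Type*} [Group F] (X Y : FreeFactorVertex F) : Prop :=
  ∃ H K : Subgroup F, SubgroupConjClass.mk H = X.1 ∧ SubgroupConjClass.mk K = Y.1 ∧ H ≤ K

/-- The free factor complex of `F`: the simplices are the nonempty finite sets of vertices that
form a chain for inclusion up to conjugation. -/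
def freeFactorComplex (F : Type*) [Group F] : AbstractSimplicialComplex (FreeFactorVertex F) where
  faces := {s | s.Nonempty ∧ IsChain FreeFactorVertex.Incl (s : Set (FreeFactorVertex F))}
  isRelLowerSet_faces := fun {_} hs =>
    ⟨hs.1, fun _ hts ht => ⟨ht, hs.2.mono (Finset.coe_subset.mpr hts)⟩⟩
  singleton_mem := fun v => ⟨Finset.singleton_nonempty v, by simp⟩

/-- `X` properly contains `A` up to conjugation. -/
def ProperlyContains {F : Type*} [Group F] (X : FreeFactorVertex F) (A : Subgroup F) : Prop :=
  ∃ H : Subgroup F, SubgroupConjClass.mk H = X.1 ∧ A < H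

/-- The upward link of `A`: the full subcomplex of the free factor complex spanned by the vertices
that properly contain `A` up to conjugation. -/
def upwardLink {F : Type*} [Group F] (A : Subgroup F) :
    PreAbstractSimplicialComplex (FreeFactorVertex F) where
  faces := {s | s ∈ (freeFactorComplex F).faces ∧ ∀ X ∈ s, ProperlyContains X A}
  isRelLowerSet_faces := fun {_} hs =>
    ⟨hs.1.1, fun _ hts ht =>
      ⟨((freeFactorComplex F).isRelLowerSet_faces hs.1).2 hts ht, fun X hX => hs.2 X (hts hX)⟩⟩

/-- The 1-skeleton of a simplicial complex, as a graph on its vertices. -/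
def oneSkeleton {V : Type*} (K : PreAbstractSimplicialComplex V) :
    SimpleGraph {v : V // {v} ∈ K.faces} where
  Adj u v := u ≠ v ∧ ∃ s ∈ K.faces, s.card = 2 ∧ u.1 ∈ s ∧ v.1 ∈ s
  symm := ⟨fun _ _ h => ⟨h.1.symm, h.2.imp fun _ hs => ⟨hs.1, hs.2.1, hs.2.2.2, hs.2.2.1⟩⟩⟩
  loopless := ⟨fun _ h => h.1 rfl⟩

/-- A simplicial complex is connected if it is nonempty and any two vertices are joined by an
edge path. -/
def IsConnectedComplex {V : Type*} (K : PreAbstractSimplicialComplex V) : Prop :=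
  (oneSkeleton K).Connected

/-! Fix a basis X of the free group that extends a basis of A. If two vertices above A are spanned
by parts of one basis extending that of A, they are joined through the factors A * ⟨x⟩, A * ⟨x, y⟩
and A * ⟨y⟩. Corank at least 3 makes A * ⟨x, y⟩ proper (`reachable_spanOn`). A Nielsen move that
leaves the basis of A alone changes a single member, so the factor spanned by the other members
serves both bases. Vertices spanned by parts of the old basis are therefore joined to those of the
new one (`Move.reachable`).

It remains to lead an arbitrary free factor H > A to X by such moves, using Nielsen reduction
relative to X twice. Reducing a basis of H alone makes the members of X lying in A appear in it up
to sign (`exists_adapted_basis`). Completing this to a basis of the whole group and reducing again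
with those members fixed ends at X up to order and sign (`exists_reachable_standard`). The second
reduction can respect the fixed members because they have length one
(`exists_move_of_not_isNielsenReduced`). -/

namespace Nielsen

open FreeGroup

/-! ### Common prefixes of words. -/

section Words

variable {β : Type*} [DecidableEq β]

/-- The length of the longest common prefix of two lists. -/
def lcpLength : List β → List β → ℕ
  | a :: l, b :: m => if a = b then lcpLength l m + 1 else 0
  | _, _ => 0

theorem le_lcpLength_iff (l m : List β) (n : ℕ) :
    n ≤ lcpLength l m ↔ n ≤ l.length ∧ n ≤ m.length ∧ l.take n = m.take n := by
  induction l generalizing m n with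
  | nil => cases n <;> simp [lcpLength]
  | cons a l ih =>
    cases m with
    | nil => cases n <;> simp [lcpLength]
    | cons b m =>
      cases n with
      | zero => simp
      | succ n =>
        by_cases h : a = b
        · simp [lcpLength, h, ih]
        · simp [lcpLength, h]

theorem lcpLength_comm (l m : List β) : lcpLength l m = lcpLength m l := by
  refine le_antisymm ?_ ?_
  · obtain ⟨h₁, h₂, h₃⟩ := (le_lcpLength_iff l m _).1 le_rfl
    exact (le_lcpLength_iff _ _ _).2 ⟨h₂, h₁, h₃.symm⟩
  · obtain ⟨h₁, h₂, h₃⟩ := (le_lcpLength_iff m l _).1 le_rfl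
    exact (le_lcpLength_iff _ _ _).2 ⟨h₂, h₁, h₃.symm⟩

theorem min_lcpLength_le (k l m : List β) :
    min (lcpLength k l) (lcpLength l m) ≤ lcpLength k m := by
  obtain ⟨h₁, _, h₃⟩ := (le_lcpLength_iff k l _).1 (min_le_left _ (lcpLength l m))
  obtain ⟨_, k₂, k₃⟩ := (le_lcpLength_iff l m _).1 (min_le_right (lcpLength k l) _)
  exact (le_lcpLength_iff _ _ _).2 ⟨h₁, k₂, h₃.trans k₃⟩

end Words

/-! ### Cancellation in products of reduced words. -/

section Cancellation

variable {α : Type*} [DecidableEq α]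

/-- The length of the longest common prefix of the reduced words of `x` and `y`. -/
def common (x y : FreeGroup α) : ℕ := lcpLength x.toWord y.toWord

theorem common_comm (x y : FreeGroup α) : common x y = common y x := lcpLength_comm _ _

/-- Common prefix length is ultrametric: among three words, the smallest of the three pairwise
values occurs at least twice. -/
theorem common_eq_of_lt {x y z : FreeGroup α} (h : common x y < common y z) :
    common x z = common x y := by
  have h₁ := min_lcpLength_le x.toWord y.toWord z.toWord
  have h₂ := min_lcpLength_le x.toWord z.toWord y.toWord
  rw [lcpLength_comm z.toWord] at h₂
  unfold common at *
  omega

theorem isReduced_invRev {L : List (α × Bool)} (h : IsReduced L) : IsReduced (invRev L) := by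
  rw [isReduced_iff_reduce_eq] at h ⊢
  rw [reduce_invRev, h]

/-- Reducing the concatenation removes the common prefix from both words. Nothing further cancels,
because the next letters differ. -/
theorem length_reduce_invRev_append {L M : List (α × Bool)} (hL : IsReduced L)
    (hM : IsReduced M) :
    (reduce (invRev L ++ M)).length + 2 * lcpLength L M = L.length + M.length := by
  induction L generalizing M with
  | nil => simp [lcpLength, hM.reduce_eq]
  | cons a L ih =>
    cases M with
    | nil => simp [lcpLength, (isReduced_invRev hL).reduce_eq]
    | cons b M =>
      by_cases hab : a = b
      · subst hab
        have h : reduce (invRev (a :: L) ++ a :: M) = reduce (invRev L ++ M) := by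
          apply reduce.sound
          rw [← mul_mk, ← mul_mk, ← inv_mk, ← inv_mk, ← List.singleton_append,
            ← List.singleton_append (l := M), ← mul_mk, ← mul_mk]
          group
        have := ih (M := M) (hL.infix ⟨[a], [], by simp⟩) (hM.infix ⟨[a], [], by simp⟩)
        rw [h]
        simp only [lcpLength, if_true, List.length_cons]
        omega
      · have h : IsReduced (invRev (a :: L) ++ b :: M) := by
          unfold FreeGroup.IsReduced
          rw [List.isChain_append]
          refine ⟨isReduced_invRev hL, hM, ?_⟩
          intro x hx y hy
          simp only [invRev, List.map_cons, List.reverse_cons, List.getLast?_append,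
            List.getLast?_singleton, Option.some_or, Option.mem_def, Option.some.injEq,
            List.head?_cons] at hx hy
          subst hx hy
          intro h₁
          by_contra h₂
          apply hab
          ext
          · exact h₁
          · revert h₂
            cases a.2 <;> cases b.2 <;> simp
        rw [h.reduce_eq]
        simp [lcpLength, hab]

theorem norm_inv_mul (x y : FreeGroup α) :
    (x⁻¹ * y).norm + 2 * common x y = x.norm + y.norm := by
  have := length_reduce_invRev_append (isReduced_toWord (x := x)) (isReduced_toWord (x := y))
  rwa [← toWord_inv, ← toWord_mul] at this

theorem norm_mul (x y : FreeGroup α) :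
    (x * y).norm + 2 * common x⁻¹ y = x.norm + y.norm := by
  simpa using norm_inv_mul x⁻¹ y

/-- A nontrivial element cannot cancel half of itself against a copy of itself. -/
theorem two_mul_common_inv_lt {g : FreeGroup α} (hg : g ≠ 1) : 2 * common g g⁻¹ < g.norm := by
  by_contra! hlt
  obtain ⟨h₁, h₂, h₃⟩ := (le_lcpLength_iff g.toWord g⁻¹.toWord _).1 le_rfl
  change common g g⁻¹ ≤ _ at h₁ h₂
  change g.toWord.take (common g g⁻¹) = _ at h₃
  have hred := isReduced_toWord (x := g)
  have hpos : 0 < g.toWord.length := by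
    rw [List.length_pos_iff]; simpa using hg
  change _ = List.take (common g g⁻¹) _ at h₃
  rw [toWord_inv] at h₃
  unfold FreeGroup.norm at hlt
  set t := common g g⁻¹
  set w := g.toWord
  have key : ∀ j (hj : j < t), w[j]'(by omega) =
      ((w[w.length - 1 - j]'(by omega)).1, !(w[w.length - 1 - j]'(by omega)).2) := by
    intro j hj
    have h := congrArg (fun l => l[j]?) h₃
    have hjw : j < w.length := by omega
    simp only [List.getElem?_take, hj, if_true] at h
    rw [List.getElem?_eq_getElem hjw, List.getElem?_eq_getElem (by simpa using hjw)] at h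
    simpa [invRev] using h
  -- By `key`, letters placed symmetrically about the centre are mutually inverse. In even length
  -- the two central letters would then cancel; in odd length the central letter would be its own
  -- inverse.
  obtain ⟨m, hm | hm⟩ := Nat.even_or_odd' w.length
  · have h := key (m - 1) (by omega)
    have hc := (List.isChain_iff_getElem.1 hred) (m - 1) (by omega)
    have hi : w.length - 1 - (m - 1) = m - 1 + 1 := by omega
    simp only [hi] at h
    rw [h] at hc
    simp at hc
  · have h := key m (by omega)
    have hi : w.length - 1 - m = m := by omega
    simp only [hi] at h
    have := congrArg Prod.snd h
    simp at this

theorem toWord_eq_of_length_le {L : List (α × Bool)} (h : L.length ≤ (mk L).norm) :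
    (mk L).toWord = L := by
  rw [toWord_mk]
  have hs : (reduce L).Sublist L := Red.sublist reduce.red
  exact hs.eq_of_length_le h

end Cancellation

/-! ### A tie-break between elements of equal length. -/

section TieBreak

variable {α : Type*} [Fintype α]

/-- A numerical code of a word, injective on words of a given length. -/
noncomputable def code (L : List (α × Bool)) : ℕ :=
  Nat.ofDigits (Fintype.card (α × Bool) + 2)
    (L.map fun a => (Fintype.equivFin (α × Bool) a : ℕ))

theorem code_append (L M : List (α × Bool)) :
    code (L ++ M) = code L + (Fintype.card (α × Bool) + 2) ^ L.length * code M := by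
  simp [code, Nat.ofDigits_append]

theorem code_inj {L M : List (α × Bool)} (h : L.length = M.length) (hc : code L = code M) :
    L = M := by
  have h' := Nat.ofDigits_inj_of_len_eq (b := Fintype.card (α × Bool) + 2) (by omega)
    (by simpa using h) (fun l hl => by simp at hl; grind) (fun l hl => by simp at hl; grind) hc
  refine List.map_injective_iff.2 ?_ h'
  intro a b hab
  exact (Fintype.equivFin (α × Bool)).injective (Fin.ext hab)

variable [DecidableEq α]

/-- The sum of the codes of the two initial halves of the words of `g` and `g⁻¹`. -/
noncomputable def halfCode (g : FreeGroup α) : ℕ :=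
  code (g.toWord.take (g.norm / 2)) + code (g⁻¹.toWord.take (g.norm / 2))

theorem halfCode_inv (g : FreeGroup α) : halfCode g⁻¹ = halfCode g := by
  simp [halfCode, norm_inv_eq, add_comm]

/-- Replacing the initial part of `w` that cancels against the second half of `v` by the
first half of `v`. -/
theorem halfCode_mul_lt {v w : FreeGroup α} {l : ℕ} (hv : v.norm = 2 * l)
    (hc : common v⁻¹ w = l) (hw : 2 * l ≤ w.norm)
    (hlt : code (v.toWord.take l) < code (v⁻¹.toWord.take l)) :
    (v * w).norm = w.norm ∧ halfCode (v * w) < halfCode w := by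
  have hn : (v * w).norm = w.norm := by
    have := norm_mul v w
    omega
  refine ⟨hn, ?_⟩
  obtain ⟨h₁, h₂, h₃⟩ := (le_lcpLength_iff v⁻¹.toWord w.toWord l).1 hc.ge
  set q := v.toWord.take l with hq
  set r := v⁻¹.toWord.take l with hr
  set s := w.toWord.drop l with hs
  have hvl : v.toWord.length = 2 * l := hv
  have hwl : w.toWord.length = w.norm := rfl
  have hql : q.length = l := by simp [hq]; omega
  have hrl : r.length = l := by simp [hr]; omega
  have hsl : s.length = w.norm - l := by simp [hs, hwl]
  have hwrs : w.toWord = r ++ s := by rw [h₃, hs, List.take_append_drop]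
  have hvq : v.toWord = q ++ invRev r := by
    have h : invRev r = v.toWord.drop l := by
      rw [hr, toWord_inv]
      simp only [invRev, List.take_reverse, List.reverse_reverse, List.map_reverse,
        List.map_drop, List.map_map, List.length_map, hvl]
      have : ((fun g : α × Bool => (g.1, !g.2)) ∘ fun g : α × Bool => (g.1, !g.2)) = id := by
        ext x <;> simp
      rw [this, List.map_id]
      congr 1
      omega
    rw [h, hq, List.take_append_drop]
  have hmk : v * w = mk (q ++ s) := by
    conv_lhs => rw [← mk_toWord (x := v), ← mk_toWord (x := w), hvq, hwrs]
    rw [← mul_mk, ← mul_mk, ← mul_mk, ← inv_mk]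
    group
  have hword : (v * w).toWord = q ++ s := by
    rw [hmk]
    apply toWord_eq_of_length_le
    rw [← hmk, hn, List.length_append]
    omega
  -- The replaced prefix lies inside the first half of `w`, and the first half of `w⁻¹` only sees
  -- the unchanged suffix `s`. Hence only the prefix codes differ.
  have hle : l ≤ w.norm / 2 := by omega
  have hle' : w.norm / 2 ≤ (invRev s).length := by rw [invRev_length]; omega
  unfold halfCode
  rw [hn, toWord_inv, toWord_inv, hword, hwrs, invRev_append, invRev_append,
    List.take_append_of_le_length hle', List.take_append_of_le_length hle',
    List.take_append, List.take_append, List.take_of_length_le (l := q) (by omega),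
    List.take_of_length_le (l := r) (by omega), code_append, code_append, hql, hrl]
  omega

end TieBreak

end Nielsen

namespace Nielsen

open FreeGroup

/-! ### Elementary Nielsen moves. -/

section Moves

variable {I G : Type*} [Group G]

/-- The member `Y i` of a family, or its inverse, according to the sign. -/
def signed (Y : I → G) (p : I × Bool) : G := cond p.2 (Y p.1) (Y p.1)⁻¹

/-- The same index with the opposite sign. -/
def opp (p : I × Bool) : I × Bool := (p.1, !p.2)

@[simp]
theorem opp_opp (p : I × Bool) : opp (opp p) = p := by simp [opp]

theorem opp_ne (p : I × Bool) : opp p ≠ p := by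
  intro h
  simpa [opp] using congrArg Prod.snd h

theorem signed_opp (Y : I → G) (p : I × Bool) : signed Y (opp p) = (signed Y p)⁻¹ := by
  obtain ⟨i, b⟩ := p
  cases b <;> simp [signed, opp]

theorem map_signed {H : Type*} [Group H] (f : G →* H) (Y : I → G) (p : I × Bool) :
    f (signed Y p) = signed (f ∘ Y) p := by
  obtain ⟨i, b⟩ := p
  cases b <;> simp [signed]

theorem lift_mk_eq_prod_signed (Y : I → G) (L : List (I × Bool)) :
    FreeGroup.lift Y (mk L) = (L.map (signed Y)).prod := rfl

variable [DecidableEq I]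

/-- An elementary Nielsen move that changes no member of the family with index in `S`. -/
def Move (S : Set I) (Y Y' : I → G) : Prop :=
  ∃ i ∉ S, ∃ j ≠ i, ∃ δ ε : Bool,
    Y' = Function.update Y i (signed Y (j, δ) * signed Y (i, ε))

/-- A move is precomposition with an automorphism of the free group on the index set, so it
preserves freeness and the generated subgroup. -/
theorem Move.exists_mulEquiv {S : Set I} {Y Y' : I → G} (h : Move S Y Y') :
    ∃ θ : FreeGroup I ≃* FreeGroup I,
      FreeGroup.lift Y' = (FreeGroup.lift Y).comp θ.toMonoidHom := by
  obtain ⟨i, -, j, hj, δ, ε, rfl⟩ := h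
  let v : FreeGroup I := signed FreeGroup.of (j, δ)
  let f : FreeGroup I →* FreeGroup I :=
    FreeGroup.lift (Function.update FreeGroup.of i (v * signed FreeGroup.of (i, ε)))
  -- The inverse substitution comes from solving `y = v * x` or `y = v * x⁻¹` for `x`.
  let g : FreeGroup I →* FreeGroup I :=
    FreeGroup.lift (Function.update FreeGroup.of i
      (cond ε (v⁻¹ * FreeGroup.of i) ((FreeGroup.of i)⁻¹ * v)))
  have hfv : f v = v := by
    cases δ <;> simp [f, v, signed, hj]
  have hgv : g v = v := by
    cases δ <;> simp [g, v, signed, hj]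
  have hfi : f (FreeGroup.of i) = v * signed FreeGroup.of (i, ε) := by simp [f]
  have hgi : g (FreeGroup.of i) = cond ε (v⁻¹ * FreeGroup.of i) ((FreeGroup.of i)⁻¹ * v) := by
    simp [g]
  have hfg : f.comp g = MonoidHom.id _ := by
    ext k
    by_cases hk : k = i
    · subst hk
      cases ε <;> simp [hgi, hfi, hfv, signed]
    · simp [f, g, hk]
  have hgf : g.comp f = MonoidHom.id _ := by
    ext k
    by_cases hk : k = i
    · subst hk
      cases ε <;> simp [hgi, hfi, hgv, signed]
    · simp [f, g, hk]
  refine ⟨MonoidHom.toMulEquiv f g hgf hfg, ?_⟩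
  ext k
  by_cases hk : k = i
  · subst hk
    change _ = FreeGroup.lift Y (f (FreeGroup.of k))
    rw [hfi]
    cases δ <;> cases ε <;> simp [v, signed]
  · change _ = FreeGroup.lift Y (f (FreeGroup.of k))
    simp [f, hk]

theorem Move.injective {S : Set I} {Y Y' : I → G} (h : Move S Y Y')
    (hY : Function.Injective (FreeGroup.lift Y)) : Function.Injective (FreeGroup.lift Y') := by
  obtain ⟨θ, hθ⟩ := h.exists_mulEquiv
  rw [hθ]
  exact hY.comp θ.injective

theorem Move.range_lift {S : Set I} {Y Y' : I → G} (h : Move S Y Y') :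
    (FreeGroup.lift Y').range = (FreeGroup.lift Y).range := by
  obtain ⟨θ, hθ⟩ := h.exists_mulEquiv
  rw [hθ, MonoidHom.range_comp]
  have : θ.toMonoidHom.range = ⊤ := MonoidHom.range_eq_top.2 θ.surjective
  rw [this, MonoidHom.range_eq_map]

theorem Move.apply_eq {S : Set I} {Y Y' : I → G} (h : Move S Y Y') {i : I} (hi : i ∈ S) :
    Y' i = Y i := by
  obtain ⟨k, hk, j, -, δ, ε, rfl⟩ := h
  rw [Function.update_of_ne]
  rintro rfl
  exact hk hi

theorem Move.comp {H : Type*} [Group H] {S : Set I} {Y Y' : I → G} (f : G →* H)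
    (h : Move S Y Y') : Move S (f ∘ Y) (f ∘ Y') := by
  obtain ⟨i, hi, j, hj, δ, ε, rfl⟩ := h
  refine ⟨i, hi, j, hj, δ, ε, ?_⟩
  rw [Function.comp_update, _root_.map_mul, map_signed, map_signed]

end Moves

/-! ### Nielsen reduced families do not shorten words. -/

section Reduced

variable {α I : Type*} [DecidableEq α]

/-- A Nielsen reduced family in a free group: no member is trivial, in a product of two members
or inverses at most half of either cancels, and in a product of three the middle one does not
cancel completely. -/
structure IsNielsenReduced (Y : I → FreeGroup α) : Prop where
  norm_pos : ∀ p, 0 < (signed Y p).norm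
  left : ∀ p q, q ≠ opp p → 2 * common (signed Y p)⁻¹ (signed Y q) ≤ (signed Y p).norm
  right : ∀ p q, q ≠ opp p → 2 * common (signed Y p)⁻¹ (signed Y q) ≤ (signed Y q).norm
  middle : ∀ p q r, q ≠ opp p → r ≠ opp q →
    common (signed Y p)⁻¹ (signed Y q) + common (signed Y q)⁻¹ (signed Y r) < (signed Y q).norm

/-- Induction on the word. By `middle`, the part of the first factor surviving on its right is
longer than what `x` cancels, so by the ultrametric property `x` sees only that factor. Each factor
thus contributes at least one letter to the length. -/
theorem IsNielsenReduced.common_prod {Y : I → FreeGroup α} (hY : IsNielsenReduced Y)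
    (L : List (I × Bool)) : ∀ p, IsReduced (p :: L) → ∀ x, p ≠ opp x →
      common (signed Y x)⁻¹ ((p :: L).map (signed Y)).prod =
        common (signed Y x)⁻¹ (signed Y p) ∧
      common (signed Y x)⁻¹ (signed Y p) + (p :: L).length ≤
        ((p :: L).map (signed Y)).prod.norm := by
  induction L with
  | nil =>
    intro p _ x hx
    have h₁ := hY.norm_pos p
    have h₂ := hY.right x p hx
    simp
    omega
  | cons q L ih =>
    intro p hp x hx
    rw [isReduced_cons_cons] at hp
    have hqp : q ≠ opp p := by
      rintro rfl
      simpa [opp] using hp.1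
    obtain ⟨h₁, h₂⟩ := ih q hp.2 p hqp
    have h₃ := hY.middle x p q hx hqp
    rw [List.map_cons, List.prod_cons, List.length_cons]
    set g := ((q :: L).map (signed Y)).prod
    have h₄ := norm_mul (signed Y p) g
    have h₅ := norm_inv_mul (signed Y p) (signed Y p * g)
    rw [inv_mul_cancel_left] at h₅
    have h₆ : common (signed Y x)⁻¹ (signed Y p) < common (signed Y p) (signed Y p * g) := by
      omega
    exact ⟨common_eq_of_lt h₆, by omega⟩

theorem IsNielsenReduced.norm_le_norm_lift [DecidableEq I] {Y : I → FreeGroup α}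
    (hY : IsNielsenReduced Y) (g : FreeGroup I) : g.norm ≤ (FreeGroup.lift Y g).norm := by
  have hg := isReduced_toWord (x := g)
  unfold FreeGroup.norm
  conv_rhs => rw [← mk_toWord (x := g), lift_mk_eq_prod_signed]
  cases hL : g.toWord with
  | nil => simp
  | cons p L =>
    rw [hL] at hg
    have := (hY.common_prod L p hg p (opp_ne p).symm).2
    exact le_trans (by omega) this

theorem eq_of_norm_eq_one {g : FreeGroup α} (hg : g.norm = 1) :
    ∃ p : α × Bool, g = signed FreeGroup.of p := by
  obtain ⟨p, hp⟩ := List.length_eq_one_iff.1 hg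
  refine ⟨p, ?_⟩
  have h : FreeGroup.lift FreeGroup.of (mk [p]) = mk [p] := by simp [FreeGroup.lift_of_eq_id]
  rw [← mk_toWord (x := g), hp, ← h, lift_mk_eq_prod_signed]
  simp

/-- Since substitution does not shorten words, an element of length one comes from a word of length
one. -/
theorem IsNielsenReduced.exists_eq_signed {Y : I → FreeGroup α} (hY : IsNielsenReduced Y)
    {g : FreeGroup α} (hg : g.norm = 1) (hmem : g ∈ (FreeGroup.lift Y).range) :
    ∃ p, g = signed Y p := by
  classical
  obtain ⟨w, rfl⟩ := hmem
  have h₁ := hY.norm_le_norm_lift w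
  have h₂ : w.norm ≠ 0 := by
    intro h
    rw [FreeGroup.norm_eq_zero] at h
    subst h
    simp at hg
  obtain ⟨p, rfl⟩ := eq_of_norm_eq_one (g := w) (by omega)
  refine ⟨p, ?_⟩
  rw [map_signed]
  congr 1
  ext i
  simp

end Reduced

/-! ### Termination of Nielsen reduction with fixed members of length one. -/

section Reduction

variable {α I : Type*} [DecidableEq α]

theorem norm_signed (Y : I → FreeGroup α) (p : I × Bool) : (signed Y p).norm = (Y p.1).norm := by
  obtain ⟨i, b⟩ := p
  cases b <;> simp [signed, norm_inv_eq]

theorem halfCode_signed [Fintype α] (Y : I → FreeGroup α) (p : I × Bool) :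
    halfCode (signed Y p) = halfCode (Y p.1) := by
  obtain ⟨i, b⟩ := p
  cases b <;> simp [signed, halfCode_inv]

theorem fst_ne_of_ne {p q : I × Bool} (h₁ : q ≠ opp p) (h₂ : q ≠ p) : p.1 ≠ q.1 := by
  obtain ⟨i, b⟩ := p
  obtain ⟨j, c⟩ := q
  intro h
  simp only at h
  subst h
  cases b <;> cases c <;> simp [opp] at h₁ h₂

variable [Fintype I] [DecidableEq I] [Fintype α]

/-- The quantity that decreases in Nielsen reduction. -/
noncomputable def complexity (Y : I → FreeGroup α) : ℕ ×ₗ ℕ :=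
  toLex (∑ i, (Y i).norm, ∑ i, halfCode (Y i))

theorem complexity_update_lt {Y : I → FreeGroup α} {i : I} {g : FreeGroup α}
    (h : g.norm < (Y i).norm ∨ g.norm = (Y i).norm ∧ halfCode g < halfCode (Y i)) :
    complexity (Function.update Y i g) < complexity Y := by
  have key : ∀ f : FreeGroup α → ℕ, ∑ k, f (Function.update Y i g k) + f (Y i) =
      ∑ k, f (Y k) + f g := by
    intro f
    rw [← Finset.add_sum_erase _ _ (Finset.mem_univ i),
      ← Finset.add_sum_erase (a := i) _ (fun k => f (Y k)) (Finset.mem_univ i)]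
    have : ∑ x ∈ Finset.univ.erase i, f (Function.update Y i g x) =
        ∑ x ∈ Finset.univ.erase i, f (Y x) :=
      Finset.sum_congr rfl fun k hk => by
        rw [Function.update_of_ne (Finset.ne_of_mem_erase hk)]
    rw [this, Function.update_self]
    omega
  have h₁ := key FreeGroup.norm
  have h₂ := key halfCode
  unfold complexity
  rw [Prod.Lex.toLex_lt_toLex]
  simp only
  omega

/-- A family whose complexity no allowed move lowers is reduced: minimal length gives the two
half-cancellation conditions, and the tie-break gives the condition on the middle factor. -/
theorem exists_move_of_not_isNielsenReduced {S : Set I} {Y : I → FreeGroup α}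
    (hY : Function.Injective (FreeGroup.lift Y)) (hS : ∀ i ∈ S, (Y i).norm = 1)
    (hred : ¬ IsNielsenReduced Y) : ∃ Y', Move S Y Y' ∧ complexity Y' < complexity Y := by
  by_contra! hmin
  have hstep : ∀ p q : I × Bool, p.1 ≠ q.1 → q.1 ∉ S →
      ¬ ((signed Y p * signed Y q).norm < (signed Y q).norm ∨
        (signed Y p * signed Y q).norm = (signed Y q).norm ∧
          halfCode (signed Y p * signed Y q) < halfCode (signed Y q)) := by
    intro p q hpq hq h
    rw [norm_signed Y q, halfCode_signed Y q] at h
    exact absurd (complexity_update_lt h) (not_lt.2 (hmin _ ⟨q.1, hq, p.1, hpq, p.2, q.2, rfl⟩))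
  have hinj : ∀ p q, signed Y p = signed Y q → p.1 = q.1 := by
    intro p q h
    have hs : ∀ p, signed Y p = FreeGroup.lift Y (signed FreeGroup.of p) := by
      intro p
      rw [map_signed]
      congr 1
      ext i
      simp
    rw [hs, hs] at h
    have h' := congrArg toWord (hY h)
    obtain ⟨i, b⟩ := p
    obtain ⟨j, c⟩ := q
    revert h'
    cases b <;> cases c <;> simp [signed, toWord_inv, invRev]
  have hne : ∀ p, signed Y p ≠ 1 := by
    rintro ⟨i, b⟩ h
    have : FreeGroup.lift Y (FreeGroup.of i) = FreeGroup.lift Y 1 := by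
      cases b <;> simpa [signed] using h
    exact of_ne_one i (hY this)
  have hpos : ∀ p, 0 < (signed Y p).norm := fun p =>
    Nat.pos_of_ne_zero fun h => hne p (FreeGroup.norm_eq_zero.1 h)
  have hself : ∀ p, 2 * common (signed Y p)⁻¹ (signed Y p) < (signed Y p).norm := by
    intro p
    rw [common_comm]
    exact two_mul_common_inv_lt (hne p)
  have hleft : ∀ p q, q ≠ opp p →
      2 * common (signed Y p)⁻¹ (signed Y q) ≤ (signed Y p).norm := by
    intro p q hpq
    by_cases hqp : q = p
    · subst hqp
      exact (hself q).le
    have hidx := fst_ne_of_ne hpq hqp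
    have hn := norm_mul (signed Y p) (signed Y q)
    by_contra! hlt
    -- If the member to be replaced is fixed, it has length one, and such excess cancellation would
    -- make the product trivial, contradicting freeness.
    by_cases hq : q.1 ∈ S
    · have h₁ := hS _ hq
      rw [← norm_signed Y q] at h₁
      have h₂ : (signed Y p * signed Y q).norm = 0 := by omega
      rw [FreeGroup.norm_eq_zero, mul_eq_one_iff_inv_eq, ← signed_opp] at h₂
      exact hidx (hinj (opp p) q h₂)
    · exact hstep p q hidx hq (Or.inl (by omega))
  have hsymm : ∀ p q, common (signed Y p)⁻¹ (signed Y q) =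
      common (signed Y (opp q))⁻¹ (signed Y (opp p)) := by
    intro p q
    rw [signed_opp, signed_opp, inv_inv, common_comm]
  have hopp : ∀ p q : I × Bool, q ≠ opp p → opp p ≠ opp (opp q) := by
    intro p q h
    rw [opp_opp]
    exact h.symm
  have hright : ∀ p q, q ≠ opp p →
      2 * common (signed Y p)⁻¹ (signed Y q) ≤ (signed Y q).norm := by
    intro p q hpq
    have := hleft (opp q) (opp p) (hopp p q hpq)
    rwa [← hsymm, norm_signed Y (opp q),
      show (opp q).1 = q.1 from rfl, ← norm_signed Y q] at this
  have hshift : ∀ q r : I × Bool, r ≠ opp q → r ≠ q →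
      2 * common (signed Y q)⁻¹ (signed Y r) = (signed Y q).norm →
      code ((signed Y (opp q)).toWord.take (common (signed Y q)⁻¹ (signed Y r))) ≤
        code ((signed Y q).toWord.take (common (signed Y q)⁻¹ (signed Y r))) := by
    intro q r h₁ h₂ h₃
    by_contra! hlt
    rw [signed_opp] at hlt
    -- A fixed member has length one, too short for the positive cancellation, which is at most half
    -- of it.
    have hr : r.1 ∉ S := by
      intro h
      have h₄ := hS _ h
      rw [← norm_signed Y r] at h₄
      have h₅ := hright q r h₁
      have h₆ := hpos q
      omega
    exact hstep q r (fst_ne_of_ne h₁ h₂) hr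
      (Or.inr (halfCode_mul_lt h₃.symm rfl (hright q r h₁) hlt))
  refine hred ⟨hpos, hleft, hright, ?_⟩
  intro p q r hpq hqr
  have h₁ := hright p q hpq
  have h₂ := hleft q r hqr
  by_cases hqp : q = p
  · subst hqp
    have := hself q
    omega
  by_cases hrq : r = q
  · subst hrq
    have := hself r
    omega
  -- Otherwise exactly half of `q` cancels on each side. Minimality of the codes on both sides
  -- forces the first halves of `q` and `q⁻¹` to coincide, against `hself`.
  by_contra! hge
  have h₃ := hshift q r hqr hrq (by omega)
  have h₄ := hshift (opp q) (opp p) (hopp p q hpq)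
    (fun h => hqp (by rw [← opp_opp q, ← h, opp_opp]))
    (by rw [← hsymm, norm_signed, show (opp q).1 = q.1 from rfl, ← norm_signed Y q]; omega)
  rw [← hsymm, opp_opp, show common (signed Y p)⁻¹ (signed Y q) =
    common (signed Y q)⁻¹ (signed Y r) by omega] at h₄
  set l := common (signed Y q)⁻¹ (signed Y r)
  have hq : (signed Y q).toWord.length = 2 * l := by
    change (signed Y q).norm = _
    omega
  have hq' : (signed Y (opp q)).toWord.length = 2 * l := by
    rw [signed_opp, toWord_inv, invRev_length, hq]
  have heq := code_inj (by simp [hq, hq']) (le_antisymm h₃ h₄)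
  rw [signed_opp] at heq hq'
  have h₅ := (le_lcpLength_iff (signed Y q)⁻¹.toWord (signed Y q).toWord l).2
    ⟨by omega, by omega, heq⟩
  have h₆ := hself q
  unfold common at h₆
  change _ < (signed Y q).toWord.length at h₆
  omega

end Reduction

/-- Every free family in a free group of finite rank can be transformed into a Nielsen reduced
one by elementary moves that keep a given set of members of length one. -/
theorem exists_isNielsenReduced {α I : Type*} [DecidableEq α] [Finite α] [DecidableEq I]
    [Finite I] (S : Set I) (Y : I → FreeGroup α)
    (hY : Function.Injective (FreeGroup.lift Y)) (hS : ∀ i ∈ S, (Y i).norm = 1) :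
    ∃ Y', Relation.ReflTransGen (Move S) Y Y' ∧ IsNielsenReduced Y' := by
  have := Fintype.ofFinite α
  have := Fintype.ofFinite I
  induction hc : complexity Y using WellFoundedLT.induction generalizing Y with
  | ind c ih =>
    by_cases hred : IsNielsenReduced Y
    · exact ⟨Y, .refl, hred⟩
    obtain ⟨Y₁, hmove, hlt⟩ := exists_move_of_not_isNielsenReduced hY hS hred
    obtain ⟨Y₂, h₁, h₂⟩ := ih _ (hc ▸ hlt) Y₁ (hmove.injective hY)
      (fun i hi => by rw [hmove.apply_eq hi, hS i hi]) rfl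
    exact ⟨Y₂, .head hmove h₁, h₂⟩

end Nielsen

namespace Nielsen

/-! ### Free factors spanned by parts of a basis. -/

section Span

variable {I J F : Type*} [Group F]

/-- The subgroup generated by the members of a family with index in `T`. -/
def spanOn (Y : I → F) (T : Set I) : Subgroup F := Subgroup.closure (Y '' T)

theorem mem_spanOn {Y : I → F} {T : Set I} {i : I} (hi : i ∈ T) : Y i ∈ spanOn Y T :=
  Subgroup.subset_closure ⟨i, hi, rfl⟩

theorem spanOn_mono (Y : I → F) {T T' : Set I} (h : T ⊆ T') : spanOn Y T ≤ spanOn Y T' :=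
  Subgroup.closure_mono (Set.image_mono h)

theorem spanOn_le {Y : I → F} {T : Set I} {H : Subgroup F} (h : ∀ i ∈ T, Y i ∈ H) :
    spanOn Y T ≤ H := by
  rw [spanOn, Subgroup.closure_le]
  rintro _ ⟨i, hi, rfl⟩
  exact h i hi

theorem spanOn_congr {Y Y' : I → F} {T : Set I} (h : ∀ i ∈ T, Y i = Y' i) :
    spanOn Y T = spanOn Y' T := by
  rw [spanOn, spanOn, Set.image_congr h]

theorem range_lift_eq_spanOn_univ (Y : I → F) : (FreeGroup.lift Y).range = spanOn Y Set.univ := by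
  rw [FreeGroup.range_lift_eq_closure, spanOn, Set.image_univ]

theorem signed_mem_iff {Y : I → F} {H : Subgroup F} (p : I × Bool) :
    signed Y p ∈ H ↔ Y p.1 ∈ H := by
  obtain ⟨i, b⟩ := p
  cases b <;> simp [signed]

theorem exists_hom_of_bijective_lift {Y : I → F} (hY : Function.Bijective (FreeGroup.lift Y))
    {G : Type*} [Group G] (f : I → G) : ∃ φ : F →* G, ∀ i, φ (Y i) = f i := by
  let e := MulEquiv.ofBijective _ hY
  refine ⟨(FreeGroup.lift f).comp e.symm.toMonoidHom, fun i => ?_⟩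
  have : e.symm (Y i) = FreeGroup.of i := by
    rw [MulEquiv.symm_apply_eq]
    simp [e]
  simp [this]

theorem hom_ext_of_surjective_lift {Y : I → F} (hY : Function.Surjective (FreeGroup.lift Y))
    {G : Type*} [Group G] {φ ψ : F →* G} (h : ∀ i, φ (Y i) = ψ (Y i)) : φ = ψ := by
  have h' : φ.comp (FreeGroup.lift Y) = ψ.comp (FreeGroup.lift Y) := by
    ext i
    simpa using h i
  ext x
  obtain ⟨w, rfl⟩ := hY x
  exact DFunLike.congr_fun h' w

/-- If `i` is outside `T`, the homomorphism to ℤ that is 1 on `Y i` and 0 on the other members kills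
the span but not `Y i`. -/
theorem mem_spanOn_iff {Y : I → F} (hY : Function.Bijective (FreeGroup.lift Y)) {T : Set I}
    {i : I} : Y i ∈ spanOn Y T ↔ i ∈ T := by
  classical
  refine ⟨fun h => ?_, mem_spanOn⟩
  by_contra hi
  obtain ⟨φ, hφ⟩ := exists_hom_of_bijective_lift hY
    (fun j => if j = i then Multiplicative.ofAdd (1 : ℤ) else 1)
  have hle : spanOn Y T ≤ φ.ker := spanOn_le fun j hj => by
    rw [MonoidHom.mem_ker, hφ, if_neg]
    rintro rfl
    exact hi hj
  have := hle h
  rw [MonoidHom.mem_ker, hφ, if_pos rfl] at this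
  exact one_ne_zero (Multiplicative.ofAdd.injective this)

/-- The inverse of the canonical map is defined on the basis, sending each member to the factor it
belongs to. -/
theorem isInternalFreeProduct_spanOn {Y : I → F} (hY : Function.Bijective (FreeGroup.lift Y))
    (T : Set I) : IsInternalFreeProduct (spanOn Y T) (spanOn Y Tᶜ) := by
  classical
  obtain ⟨φ, hφ⟩ := exists_hom_of_bijective_lift hY (fun i =>
    if h : i ∈ T then
      (Monoid.Coprod.inl ⟨Y i, mem_spanOn h⟩ : Monoid.Coprod (spanOn Y T) (spanOn Y Tᶜ))
    else Monoid.Coprod.inr ⟨Y i, mem_spanOn h⟩)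
  have h₁ : (Monoid.Coprod.lift (spanOn Y T).subtype (spanOn Y Tᶜ).subtype).comp φ =
      MonoidHom.id F := by
    refine hom_ext_of_surjective_lift hY.2 fun i => ?_
    simp only [MonoidHom.comp_apply, hφ]
    split_ifs <;> simp
  have h₂ : φ.comp (Monoid.Coprod.lift (spanOn Y T).subtype (spanOn Y Tᶜ).subtype) =
      MonoidHom.id _ := by
    refine Monoid.Coprod.hom_ext ?_ ?_
    · ext ⟨x, hx⟩
      change φ x = Monoid.Coprod.inl ⟨x, hx⟩
      unfold spanOn at hx
      induction hx using Subgroup.closure_induction with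
      | mem x hx =>
        obtain ⟨i, hi, rfl⟩ := hx
        rw [hφ, dif_pos hi]
      | one => rw [map_one]; exact (map_one _).symm
      | mul x y hx hy ihx ihy => rw [map_mul, ihx, ihy, ← map_mul]; rfl
      | inv x hx ih => rw [map_inv, ih, ← map_inv]; rfl
    · ext ⟨x, hx⟩
      change φ x = Monoid.Coprod.inr ⟨x, hx⟩
      unfold spanOn at hx
      induction hx using Subgroup.closure_induction with
      | mem x hx =>
        obtain ⟨i, hi, rfl⟩ := hx
        rw [hφ, dif_neg hi]
      | one => rw [map_one]; exact (map_one _).symm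
      | mul x y hx hy ihx ihy => rw [map_mul, ihx, ihy, ← map_mul]; rfl
      | inv x hx ih => rw [map_inv, ih, ← map_inv]; rfl
  exact Function.bijective_iff_has_inverse.2
    ⟨φ, fun x => DFunLike.congr_fun h₂ x, fun x => DFunLike.congr_fun h₁ x⟩

/-- Free families generating the factors of a free product form together a basis. -/
theorem bijective_lift_sumElim {H K : Subgroup F} (hHK : IsInternalFreeProduct H K)
    {Y : I → F} {Z : J → F} (hY : Function.Injective (FreeGroup.lift Y))
    (hYH : (FreeGroup.lift Y).range = H) (hZ : Function.Injective (FreeGroup.lift Z))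
    (hZK : (FreeGroup.lift Z).range = K) :
    Function.Bijective (FreeGroup.lift (Sum.elim Y Z)) := by
  subst hYH hZK
  let eY := MonoidHom.ofInjective hY
  let eZ := MonoidHom.ofInjective hZ
  have hYi : ∀ i, eY (FreeGroup.of i) = ⟨Y i, FreeGroup.of i, by simp⟩ := fun i =>
    Subtype.ext (by rw [MonoidHom.ofInjective_apply]; simp)
  have hZi : ∀ i, eZ (FreeGroup.of i) = ⟨Z i, FreeGroup.of i, by simp⟩ := fun i =>
    Subtype.ext (by rw [MonoidHom.ofInjective_apply]; simp)
  let f := FreeGroup.lift (Sum.elim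
    (fun i => (Monoid.Coprod.inl (eY (FreeGroup.of i)) :
      Monoid.Coprod (FreeGroup.lift Y).range (FreeGroup.lift Z).range))
    (fun i => Monoid.Coprod.inr (eZ (FreeGroup.of i))))
  let g := Monoid.Coprod.lift
    ((FreeGroup.map (Sum.inl : I → I ⊕ J)).comp eY.symm.toMonoidHom)
    ((FreeGroup.map (Sum.inr : J → I ⊕ J)).comp eZ.symm.toMonoidHom)
  have hgf : g.comp f = MonoidHom.id _ := by
    ext i
    rcases i with i | i <;> simp [f, g]
  have hfg : f.comp g = MonoidHom.id _ := by
    refine Monoid.Coprod.hom_ext ?_ ?_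
    · have : (f.comp g).comp (Monoid.Coprod.inl.comp eY.toMonoidHom) =
          Monoid.Coprod.inl.comp eY.toMonoidHom := by
        ext i
        simp [f, g]
      ext x
      obtain ⟨w, rfl⟩ := eY.surjective x
      exact DFunLike.congr_fun this w
    · have : (f.comp g).comp (Monoid.Coprod.inr.comp eZ.toMonoidHom) =
          Monoid.Coprod.inr.comp eZ.toMonoidHom := by
        ext i
        simp [f, g]
      ext x
      obtain ⟨w, rfl⟩ := eZ.surjective x
      exact DFunLike.congr_fun this w
  have hf : Function.Bijective f := Function.bijective_iff_has_inverse.2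
    ⟨g, fun x => DFunLike.congr_fun hgf x, fun x => DFunLike.congr_fun hfg x⟩
  have hcomp : FreeGroup.lift (Sum.elim Y Z) = (Monoid.Coprod.lift
      (FreeGroup.lift Y).range.subtype (FreeGroup.lift Z).range.subtype).comp f := by
    ext i
    rcases i with i | i <;> simp [f, hYi, hZi]
  rw [hcomp]
  exact hHK.comp hf

/-- A subgroup of a free group is generated by a free family. -/
theorem exists_free_family.{u} {F : Type u} [Group F] [IsFreeGroup F] (H : Subgroup F) :
    ∃ (I : Type u) (Y : I → F), Function.Injective (FreeGroup.lift Y) ∧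
      (FreeGroup.lift Y).range = H := by
  -- Freeness of `H` is the Nielsen–Schreier theorem, supplied as an instance.
  let e := IsFreeGroup.mulEquiv H
  refine ⟨IsFreeGroup.Generators H, fun i => e (FreeGroup.of i), ?_⟩
  have h : FreeGroup.lift (fun i => (e (FreeGroup.of i) : F)) =
      H.subtype.comp e.toMonoidHom := by
    ext i
    simp
  rw [h]
  refine ⟨H.subtype_injective.comp e.injective, ?_⟩
  rw [MonoidHom.range_comp, MonoidHom.range_eq_top.2 e.surjective, ← MonoidHom.range_eq_map,
    Subgroup.range_subtype]

end Span

/-! ### Vertices of the upward link as actual subgroups. -/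

section Link

variable {F : Type*} [Group F]

/-- A proper free factor that properly contains `A`. -/
structure IsLinkFactor (A H : Subgroup F) : Prop where
  isFreeFactor : IsFreeFactor H
  lt : A < H
  ne_top : H ≠ ⊤

/-- The vertex of the upward link of `A` given by a proper free factor that properly
contains `A`. -/
def linkVertex {A H : Subgroup F} (h : IsLinkFactor A H) :
    {v : FreeFactorVertex F // {v} ∈ (upwardLink A).faces} :=
  ⟨⟨SubgroupConjClass.mk H, H, rfl, h.isFreeFactor, (bot_le.trans_lt h.lt).ne', h.ne_top⟩,
    (freeFactorComplex F).singleton_mem _, fun X hX => by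
      rw [Finset.mem_singleton.1 hX]
      exact ⟨H, rfl, h.lt⟩⟩

theorem reachable_linkVertex_of_le {A H K : Subgroup F} (hH : IsLinkFactor A H)
    (hK : IsLinkFactor A K) (hle : H ≤ K) :
    (oneSkeleton (upwardLink A)).Reachable (linkVertex hH) (linkVertex hK) := by
  classical
  -- Equal vertices span no edge, so this case is separate.
  by_cases heq : linkVertex hH = linkVertex hK
  · rw [heq]
  refine SimpleGraph.Adj.reachable ⟨heq, {(linkVertex hH).1, (linkVertex hK).1}, ?_, ?_, ?_, ?_⟩
  · refine ⟨⟨Finset.insert_nonempty _ _, ?_⟩, ?_⟩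
    · rw [Finset.coe_insert, Finset.coe_singleton]
      exact IsChain.pair ⟨H, K, rfl, rfl, hle⟩
    · intro X hX
      rw [Finset.mem_insert, Finset.mem_singleton] at hX
      rcases hX with rfl | rfl
      · exact ⟨H, rfl, hH.lt⟩
      · exact ⟨K, rfl, hK.lt⟩
  · exact Finset.card_pair fun h => heq (Subtype.ext h)
  · simp
  · simp

theorem isFreeFactor_map {H : Subgroup F} (hH : IsFreeFactor H) (φ : F ≃* F) :
    IsFreeFactor (H.map φ.toMonoidHom) := by
  obtain ⟨K, hK⟩ := hH
  refine ⟨K.map φ.toMonoidHom, ?_⟩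
  let eH := H.equivMapOfInjective φ.toMonoidHom φ.injective
  let eK := K.equivMapOfInjective φ.toMonoidHom φ.injective
  have h : (Monoid.Coprod.lift (H.map φ.toMonoidHom).subtype (K.map φ.toMonoidHom).subtype).comp
      (MulEquiv.coprodCongr eH eK).toMonoidHom =
        φ.toMonoidHom.comp (Monoid.Coprod.lift H.subtype K.subtype) := by
    refine Monoid.Coprod.hom_ext ?_ ?_
    · ext x
      rfl
    · ext x
      rfl
  have h' : Function.Bijective ((Monoid.Coprod.lift (H.map φ.toMonoidHom).subtype
      (K.map φ.toMonoidHom).subtype) ∘ (MulEquiv.coprodCongr eH eK)) := by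
    have := φ.bijective.comp hK
    convert this using 1
    ext x
    exact DFunLike.congr_fun h x
  exact (Function.Bijective.of_comp_iff _ (MulEquiv.coprodCongr eH eK).bijective).1 h'

/-- The representative containing `A` need not be the one known to be a free factor, but the two are
conjugate, and conjugation preserves proper free factors. -/
theorem exists_eq_linkVertex {A : Subgroup F}
    (v : {v : FreeFactorVertex F // {v} ∈ (upwardLink A).faces}) :
    ∃ (H : Subgroup F) (h : IsLinkFactor A H), v = linkVertex h := by
  obtain ⟨v, hv⟩ := v
  obtain ⟨H, hHv, hlt⟩ := hv.2 v (Finset.mem_singleton_self v)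
  obtain ⟨K, hKv, hK, -, hKtop⟩ := v.2
  obtain ⟨g, rfl⟩ : ∃ g : F, K.map (MulAut.conj g).toMonoidHom = H :=
    Quotient.exact (hKv.trans hHv.symm)
  refine ⟨_, ⟨isFreeFactor_map hK _, hlt, fun htop => hKtop ?_⟩, ?_⟩
  · rw [eq_top_iff]
    intro x _
    have : MulAut.conj g x ∈ K.map (MulAut.conj g).toMonoidHom := htop ▸ Subgroup.mem_top _
    obtain ⟨y, hy, hxy⟩ := this
    rwa [← (MulAut.conj g).injective hxy]
  · exact Subtype.ext (Subtype.ext hHv.symm)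

end Link

/-! ### Paths within one basis and along Nielsen moves. -/

section Connectivity

variable {I F : Type*} [Group F] {A : Subgroup F}

theorem isLinkFactor_spanOn {Y : I → F} (hY : Function.Bijective (FreeGroup.lift Y)) {S T : Set I}
    (hS : spanOn Y S = A) (hST : S ⊂ T) (hT : T ≠ Set.univ) : IsLinkFactor A (spanOn Y T) := by
  refine ⟨⟨_, isInternalFreeProduct_spanOn hY T⟩, ?_, ?_⟩
  · obtain ⟨hle, i, hiT, hiS⟩ := Set.ssubset_iff_exists.1 hST
    subst hS
    exact lt_of_le_of_ne (spanOn_mono Y hle) fun h =>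
      hiS ((mem_spanOn_iff hY).1 (h ▸ mem_spanOn hiT))
  · intro h
    apply hT
    ext i
    simpa using (mem_spanOn_iff hY (T := T) (i := i)).1 (h ▸ Subgroup.mem_top _)

/-- Any two vertices spanned by subfamilies of one basis are joined by an edge path. -/
theorem reachable_spanOn {Y : I → F} (hY : Function.Bijective (FreeGroup.lift Y)) {S : Set I}
    (hS : spanOn Y S = A) (hcard : ∀ i j, ∃ k ∉ S, k ≠ i ∧ k ≠ j) {T T' : Set I}
    (hT : IsLinkFactor A (spanOn Y T)) (hT' : IsLinkFactor A (spanOn Y T')) :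
    (oneSkeleton (upwardLink A)).Reachable (linkVertex hT) (linkVertex hT') := by
  have hsub : ∀ {T}, IsLinkFactor A (spanOn Y T) → ∃ i ∈ T, i ∉ S ∧ insert i S ⊆ T := by
    intro T h
    have hle : S ⊆ T := fun i hi =>
      (mem_spanOn_iff hY).1 (h.lt.le (hS ▸ mem_spanOn hi))
    obtain ⟨i, hi, hiS⟩ : ∃ i ∈ T, i ∉ S := by
      by_contra! hcon
      exact not_lt_of_ge (hS ▸ spanOn_mono Y hcon) h.lt
    exact ⟨i, hi, hiS, Set.insert_subset hi hle⟩
  obtain ⟨i, -, hiS, hi⟩ := hsub hT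
  obtain ⟨j, -, hjS, hj⟩ := hsub hT'
  -- The third index outside `S` keeps the factor spanned by `S`, `i` and `j` proper.
  obtain ⟨k, hkS, hki, hkj⟩ := hcard i j
  have hijne : insert i (insert j S) ≠ Set.univ := fun h => by
    have : k ∈ insert i (insert j S) := h ▸ Set.mem_univ k
    simp [hki, hkj, hkS] at this
  have hlink : ∀ {T}, insert i S ⊆ T ∨ insert j S ⊆ T → T ⊆ insert i (insert j S) →
      IsLinkFactor A (spanOn Y T) := by
    intro T h h'
    refine isLinkFactor_spanOn hY hS ?_ fun hu => hijne (Set.univ_subset_iff.1 (hu ▸ h'))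
    rcases h with h | h
    · exact (Set.ssubset_insert hiS).trans_subset h
    · exact (Set.ssubset_insert hjS).trans_subset h
  have hmono : insert i S ⊆ insert i (insert j S) := Set.insert_subset_insert (Set.subset_insert _ _)
  have h₁ := hlink (Or.inl subset_rfl) hmono
  have h₂ := hlink (Or.inr subset_rfl) (Set.subset_insert _ _)
  have h₃ := hlink (Or.inl hmono) subset_rfl
  exact (reachable_linkVertex_of_le h₁ hT (spanOn_mono Y hi)).symm.trans <|
    (reachable_linkVertex_of_le h₁ h₃ (spanOn_mono Y hmono)).trans <|
    (reachable_linkVertex_of_le h₂ h₃ (spanOn_mono Y (Set.subset_insert _ _))).symm.trans <|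
    reachable_linkVertex_of_le h₂ hT' (spanOn_mono Y hj)

variable [DecidableEq I]

theorem Move.bijective {S : Set I} {Y Y' : I → F} (h : Move S Y Y')
    (hY : Function.Bijective (FreeGroup.lift Y)) : Function.Bijective (FreeGroup.lift Y') := by
  refine ⟨h.injective hY.1, ?_⟩
  rw [← MonoidHom.range_eq_top, h.range_lift, MonoidHom.range_eq_top]
  exact hY.2

/-- Vertices spanned by subfamilies of two bases related by a Nielsen move are joined by an edge
path, since the bases share all but one member. -/
theorem Move.reachable {Y Y' : I → F} {S : Set I} (h : Move S Y Y')
    (hY : Function.Bijective (FreeGroup.lift Y)) (hS : spanOn Y S = A)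
    (hcard : ∀ i j, ∃ k ∉ S, k ≠ i ∧ k ≠ j) {T T' : Set I}
    (hT : IsLinkFactor A (spanOn Y T)) (hT' : IsLinkFactor A (spanOn Y' T')) :
    (oneSkeleton (upwardLink A)).Reachable (linkVertex hT) (linkVertex hT') := by
  have hY' := h.bijective hY
  have hS' : spanOn Y' S = A := by
    rw [← hS]
    exact spanOn_congr fun i hi => h.apply_eq hi
  obtain ⟨i, hi, j, -, δ, ε, rfl⟩ := h
  -- The members other than `i` are untouched by the move; their span is the vertex shared by the
  -- two bases.
  have heq : spanOn Y {i}ᶜ = spanOn (Function.update Y i (signed Y (j, δ) * signed Y (i, ε)))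
      {i}ᶜ :=
    spanOn_congr fun k hk => by rw [Function.update_of_ne hk]
  have h₁ : IsLinkFactor A (spanOn Y {i}ᶜ) := by
    refine isLinkFactor_spanOn hY hS ?_ (by simp)
    rw [Set.ssubset_iff_exists]
    refine ⟨fun k hk => ?_, ?_⟩
    · rintro rfl
      exact hi hk
    · obtain ⟨k, hk, hki, -⟩ := hcard i i
      exact ⟨k, hki, hk⟩
  refine (reachable_spanOn hY hS hcard hT h₁).trans ?_
  have h₂ := h₁
  rw [heq] at h₂
  have : linkVertex h₁ = linkVertex h₂ := by
    congr 1
  rw [this]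
  exact reachable_spanOn hY' hS' hcard h₂ hT'

/-- The subfamily need not survive a move, so after each one any proper subfamily strictly larger
than `S` may be chosen as the new endpoint. -/
theorem exists_reachable_of_reflTransGen {Y Y' : I → F} {S : Set I}
    (h : Relation.ReflTransGen (Move S) Y Y')
    (hY : Function.Bijective (FreeGroup.lift Y)) (hS : spanOn Y S = A)
    (hcard : ∀ i j, ∃ k ∉ S, k ≠ i ∧ k ≠ j) {T : Set I} (hT : IsLinkFactor A (spanOn Y T)) :
    Function.Bijective (FreeGroup.lift Y') ∧ spanOn Y' S = A ∧
    ∃ (T' : Set I) (hT' : IsLinkFactor A (spanOn Y' T')),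
      (oneSkeleton (upwardLink A)).Reachable (linkVertex hT) (linkVertex hT') := by
  induction h with
  | refl => exact ⟨hY, hS, T, hT, .refl _⟩
  | tail _ hmove ih =>
    obtain ⟨hY₁, hS₁, T₁, hT₁, hr⟩ := ih
    have hY₂ := hmove.bijective hY₁
    have hS₂ := (spanOn_congr fun i hi => (hmove.apply_eq hi)).trans hS₁
    -- The moved index is used only as some index outside `S`.
    have ⟨i, hi, _⟩ := hmove
    have hT₂ := isLinkFactor_spanOn hY₂ hS₂ (Set.ssubset_insert hi) (by
      obtain ⟨k, hk, hki, -⟩ := hcard i i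
      intro hu
      have : k ∈ insert i S := hu ▸ Set.mem_univ k
      simp [hk, hki] at this)
    exact ⟨hY₂, hS₂, _, hT₂, hr.trans (hmove.reachable hY₁ hS₁ hcard hT₁ hT₂)⟩

end Connectivity

end Nielsen

namespace Nielsen

/-! ### Nielsen reduction relative to a standard basis. -/

section Basis

variable {α I F : Type*} [Group F]

theorem eq_signed_of_eq_signed {X : α → F} {Y : I → F} {a : α} {i : I} {b : Bool}
    (h : X a = signed Y (i, b)) : Y i = signed X (a, b) := by
  cases b <;> simp [signed] at h ⊢ <;> simp [h]

theorem exists_moves_isNielsenReduced [DecidableEq α] [Finite α] [DecidableEq I] [Finite I]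
    (e : F ≃* FreeGroup α) (S : Set I) (Y : I → F) (hY : Function.Injective (FreeGroup.lift Y))
    (hS : ∀ i ∈ S, (e (Y i)).norm = 1) :
    ∃ Y', Relation.ReflTransGen (Move S) Y Y' ∧ IsNielsenReduced (e ∘ Y') := by
  have hlift : FreeGroup.lift (e ∘ Y) = e.toMonoidHom.comp (FreeGroup.lift Y) := by
    ext i
    simp
  obtain ⟨Z, hYZ, hZ⟩ := exists_isNielsenReduced S (e ∘ Y)
    (by rw [hlift]; exact e.injective.comp hY) hS
  refine ⟨e.symm ∘ Z, ?_, ?_⟩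
  · have := Relation.ReflTransGen.lift (p := Move S) (fun Z : I → FreeGroup α => e.symm ∘ Z)
      (fun _ _ h => Move.comp e.symm.toMonoidHom h) _ _ hYZ
    convert this using 1
    ext i
    simp
  · convert hZ using 1
    ext i
    simp

theorem injective_and_range_of_reflTransGen [DecidableEq I] {S : Set I} {Y Y' : I → F}
    (h : Relation.ReflTransGen (Move S) Y Y') (hY : Function.Injective (FreeGroup.lift Y)) :
    Function.Injective (FreeGroup.lift Y') ∧
      (FreeGroup.lift Y').range = (FreeGroup.lift Y).range := by
  induction h with
  | refl => exact ⟨hY, rfl⟩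
  | tail _ hmove ih => exact ⟨hmove.injective ih.1, hmove.range_lift.trans ih.2⟩

variable [DecidableEq α] {e : F ≃* FreeGroup α} {X : α → F}

/-- A Nielsen reduced family contains, up to inversion, every member of the standard basis that
lies in the subgroup it generates. -/
theorem exists_eq_signed_of_mem_range (heX : ∀ a, e (X a) = FreeGroup.of a) {Y : I → F}
    (hred : IsNielsenReduced (e ∘ Y)) {a : α} (ha : X a ∈ (FreeGroup.lift Y).range) :
    ∃ p, X a = signed Y p := by
  obtain ⟨w, hw⟩ := ha
  obtain ⟨p, hp⟩ := hred.exists_eq_signed (FreeGroup.norm_of a) ⟨w, by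
    have : FreeGroup.lift (e ∘ Y) = e.toMonoidHom.comp (FreeGroup.lift Y) := by
      ext i
      simp
    rw [this, ← heX, ← hw]
    rfl⟩
  refine ⟨p, e.injective ?_⟩
  rw [heX, hp]
  exact (map_signed e.toMonoidHom Y p).symm

/-- A Nielsen reduced basis is the standard basis, up to order and inversion. -/
theorem exists_eq_signed_of_isNielsenReduced (heX : ∀ a, e (X a) = FreeGroup.of a)
    (hX : Function.Surjective (FreeGroup.lift X)) {Y : I → F}
    (hY : Function.Bijective (FreeGroup.lift Y)) (hred : IsNielsenReduced (e ∘ Y)) (i : I) :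
    ∃ p, Y i = signed X p := by
  by_contra! hcon
  have htop : (⊤ : Subgroup F) ≤ spanOn Y {i}ᶜ := by
    rw [← MonoidHom.range_eq_top.2 hX, range_lift_eq_spanOn_univ]
    refine spanOn_le fun a _ => ?_
    obtain ⟨⟨j, b⟩, hp⟩ := exists_eq_signed_of_mem_range heX hred
      (a := a) (MonoidHom.range_eq_top.2 hY.2 ▸ Subgroup.mem_top _)
    rw [hp, signed_mem_iff]
    refine mem_spanOn ?_
    rintro rfl
    exact hcon _ (eq_signed_of_eq_signed hp)
  exact (mem_spanOn_iff hY).1 (htop (Subgroup.mem_top (Y i))) rfl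

theorem spanOn_eq_spanOn_of_isNielsenReduced (heX : ∀ a, e (X a) = FreeGroup.of a)
    (hX : Function.Surjective (FreeGroup.lift X)) {Y : I → F}
    (hY : Function.Bijective (FreeGroup.lift Y)) (hred : IsNielsenReduced (e ∘ Y)) (T : Set I) :
    spanOn Y T = spanOn X {a | X a ∈ spanOn Y T} := by
  refine le_antisymm (spanOn_le fun i hi => ?_) (spanOn_le fun a ha => ha)
  obtain ⟨p, hp⟩ := exists_eq_signed_of_isNielsenReduced heX hX hY hred i
  rw [hp, signed_mem_iff]
  refine mem_spanOn ?_
  change X p.1 ∈ spanOn Y T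
  rw [← signed_mem_iff, ← hp]
  exact mem_spanOn hi

end Basis

/-! ### From an arbitrary factor to the standard basis. -/

theorem exists_notMem_ne_ne {I : Type*} [Finite I] {S : Set I} (h : 3 ≤ Sᶜ.ncard) (i j : I) :
    ∃ k ∉ S, k ≠ i ∧ k ≠ j := by
  by_contra! hcon
  have hsub : Sᶜ ⊆ {i, j} := fun k hk => by
    by_cases hki : k = i
    · exact Or.inl hki
    · exact Or.inr (hcon k hk hki)
  have h₁ := Set.ncard_le_ncard hsub (Set.toFinite _)
  have h₂ := Set.ncard_insert_le i {j}
  rw [Set.ncard_singleton] at h₂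
  omega

/-- A free factor that contains `A` is spanned by a subfamily of a basis that extends, up to
inversion, the standard basis of `A`. -/
theorem exists_adapted_basis.{u, v} {F : Type u} [Group F] [IsFreeGroup F] {α : Type v} [Finite α]
    [DecidableEq α] {e : F ≃* FreeGroup α} {X : α → F} (heX : ∀ a, e (X a) = FreeGroup.of a)
    {S : Set α} {A H : Subgroup F} (hS : spanOn X S = A)
    (hH : IsFreeFactor H) (hAH : A ≤ H) :
    ∃ (I : Type u) (Y : I → F) (S' T : Set I), Function.Bijective (FreeGroup.lift Y) ∧
      spanOn Y S' = A ∧ spanOn Y T = H ∧ (∀ i ∈ S', (e (Y i)).norm = 1) ∧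
      S'.ncard ≤ S.ncard := by
  classical
  obtain ⟨C, hC⟩ := hH
  obtain ⟨J, Z, hZ, hZH⟩ := exists_free_family H
  obtain ⟨K, W, hW, hWC⟩ := exists_free_family C
  have hbij := bijective_lift_sumElim hC hZ hZH hW hWC
  have : Finite (J ⊕ K) :=
    Finite.of_equiv α (Equiv.ofFreeGroupEquiv ((MulEquiv.ofBijective _ hbij).trans e)).symm
  have : Finite J := Finite.of_injective (Sum.inl : J → J ⊕ K) Sum.inl_injective
  -- Only the basis of `H` is reduced, with nothing fixed. Since `H` contains `A`, the result
  -- includes the standard generators of `A` up to sign.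
  obtain ⟨Z', hmoves, hred⟩ := exists_moves_isNielsenReduced e ∅ Z hZ (by simp)
  obtain ⟨hZ', hZ'H⟩ := injective_and_range_of_reflTransGen hmoves hZ
  rw [hZH] at hZ'H
  have hY := bijective_lift_sumElim hC hZ' hZ'H hW hWC
  set Y := Sum.elim Z' W
  let S' : Set (J ⊕ K) := {i | ∃ j, i = Sum.inl j ∧ ∃ p : α × Bool, p.1 ∈ S ∧ Y i = signed X p}
  have hS' : ∀ i ∈ S', ∃ p : α × Bool, p.1 ∈ S ∧ Y i = signed X p := by
    rintro i ⟨j, -, hp⟩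
    exact hp
  refine ⟨J ⊕ K, Y, S', Set.range Sum.inl, hY, ?_, ?_, ?_, ?_⟩
  · refine le_antisymm (spanOn_le fun i hi => ?_) ?_
    · obtain ⟨p, hp, hpi⟩ := hS' i hi
      rw [hpi, signed_mem_iff, ← hS]
      exact mem_spanOn hp
    · rw [← hS]
      refine spanOn_le fun a ha => ?_
      obtain ⟨⟨j, b⟩, hp⟩ := exists_eq_signed_of_mem_range heX hred (a := a)
        (hZ'H ▸ hAH (hS ▸ mem_spanOn ha))
      rw [hp, signed_mem_iff]
      exact mem_spanOn (Y := Y) (i := Sum.inl j)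
        ⟨j, rfl, (a, b), ha, eq_signed_of_eq_signed hp⟩
  · rw [← hZ'H, FreeGroup.range_lift_eq_closure, spanOn, ← Set.range_comp]
    rfl
  · intro i hi
    obtain ⟨p, -, hp⟩ := hS' i hi
    have heX' : e ∘ X = FreeGroup.of := funext heX
    have := map_signed e.toMonoidHom X p
    change e (signed X p) = signed (e ∘ X) p at this
    rw [hp, this, heX', norm_signed, FreeGroup.norm_of]
  -- The bound leaves at least as many indices outside `S'` as outside `S`. It holds because two
  -- members of a basis cannot be the same standard generator up to sign.
  · obtain hempty | ⟨i₀, hi₀⟩ := S'.eq_empty_or_nonempty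
    · simp [hempty]
    have : Nonempty (α × Bool) := ⟨(hS' i₀ hi₀).choose⟩
    choose! p hpS hp using hS'
    refine Set.ncard_le_ncard_of_injOn (fun i => (p i).1) hpS ?_ (Set.toFinite _)
    intro i hi j hj hij
    have h : X (p j).1 ∈ spanOn Y {j} := by
      rw [← signed_mem_iff, ← hp j hj]
      exact mem_spanOn rfl
    have h' : Y i ∈ spanOn Y {j} := by
      rw [hp i hi, signed_mem_iff]
      exact (show (p i).1 = (p j).1 from hij) ▸ h
    exact Set.mem_singleton_iff.1 ((mem_spanOn_iff hY).1 h')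

/-- Every vertex of the upward link of `A` is joined by an edge path to one spanned by a subfamily
of the standard basis. -/
theorem exists_reachable_standard {F : Type*} [Group F] [IsFreeGroup F] {α : Type*} [Finite α]
    {e : F ≃* FreeGroup α} {X : α → F} (heX : ∀ a, e (X a) = FreeGroup.of a)
    (hX : Function.Surjective (FreeGroup.lift X)) {S : Set α} {A H : Subgroup F}
    (hS : spanOn X S = A) (hcard : 3 ≤ Sᶜ.ncard) (hH : IsLinkFactor A H) :
    ∃ (T : Set α) (hT : IsLinkFactor A (spanOn X T)),
      (oneSkeleton (upwardLink A)).Reachable (linkVertex hH) (linkVertex hT) := by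
  classical
  obtain ⟨I, Y, S', T, hY, hS', rfl, hnorm, hle⟩ :=
    exists_adapted_basis heX hS hH.isFreeFactor hH.lt.le
  have eqv := Equiv.ofFreeGroupEquiv ((MulEquiv.ofBijective _ hY).trans e)
  have : Finite I := Finite.of_equiv α eqv.symm
  have hcard' : 3 ≤ S'ᶜ.ncard := by
    have h₁ := Set.ncard_add_ncard_compl S
    have h₂ := Set.ncard_add_ncard_compl S'
    have h₃ := Nat.card_congr eqv
    omega
  -- The second reduction treats the whole basis and fixes the members spanning `A`, so every
  -- intermediate basis still extends that of `A`.
  obtain ⟨Y', hmoves, hred⟩ := exists_moves_isNielsenReduced e S' Y hY.1 hnorm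
  obtain ⟨hY', -, T', hT', hreach⟩ := exists_reachable_of_reflTransGen hmoves hY hS'
    (exists_notMem_ne_ne hcard') hH
  have heq := spanOn_eq_spanOn_of_isNielsenReduced heX hX hY' hred T'
  revert hT' hreach
  rw [heq]
  exact fun hT' hreach => ⟨_, hT', hreach⟩

end Nielsen

open Nielsen

theorem mainTheorem5 (n : ℕ) (A : Subgroup (FreeGroup (Fin n))) (k : ℕ)
    (hA : HasCorank A k) (hk : 3 ≤ k) :
    IsConnectedComplex (upwardLink A) := by
  obtain ⟨B, hAB, ⟨f⟩⟩ := hA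
  obtain ⟨ι, U, hU, hUA⟩ := exists_free_family A
  let V : Fin k → FreeGroup (Fin n) := fun i => f (FreeGroup.of i)
  have hVf : FreeGroup.lift V = B.subtype.comp f.toMonoidHom := by
    ext i
    simp [V]
  have hV : Function.Injective (FreeGroup.lift V) := by
    rw [hVf]
    exact B.subtype_injective.comp f.injective
  have hVB : (FreeGroup.lift V).range = B := by
    rw [hVf, MonoidHom.range_comp, MonoidHom.range_eq_top.2 f.surjective,
      ← MonoidHom.range_eq_map, Subgroup.range_subtype]
  have hX := bijective_lift_sumElim hAB hU hUA hV hVB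
  let X := Sum.elim U V
  let e := (MulEquiv.ofBijective _ hX).symm
  have : Finite (ι ⊕ Fin k) := Finite.of_equiv (Fin n) (Equiv.ofFreeGroupEquiv e)
  have heX : ∀ a, e (X a) = FreeGroup.of a := fun a => by
    rw [MulEquiv.symm_apply_eq]
    simp [X]
  have hS : spanOn X (Set.range Sum.inl) = A := by
    rw [← hUA, FreeGroup.range_lift_eq_closure, spanOn, ← Set.range_comp]
    rfl
  have hcard : 3 ≤ (Set.range (Sum.inl : ι → ι ⊕ Fin k))ᶜ.ncard := by
    rw [Set.compl_range_inl, ← Set.image_univ, Set.ncard_image_of_injective _ Sum.inr_injective,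
      Set.ncard_univ, Nat.card_fin]
    exact hk
  have hcard' := exists_notMem_ne_ne hcard
  -- Adjoining one complementary generator to `A` gives a vertex, so the link is nonempty.
  have hT₀ : IsLinkFactor A (spanOn X (insert (Sum.inr ⟨0, by omega⟩) (Set.range Sum.inl))) := by
    refine isLinkFactor_spanOn hX hS (Set.ssubset_insert (by simp)) fun h => ?_
    obtain ⟨j, hj, hj', -⟩ := hcard' (Sum.inr ⟨0, by omega⟩) (Sum.inr ⟨0, by omega⟩)
    have : j ∈ insert (Sum.inr ⟨0, by omega⟩) (Set.range Sum.inl) := h ▸ Set.mem_univ j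
    exact this.elim hj' hj
  refine (SimpleGraph.connected_iff _).2 ⟨fun v w => ?_, ⟨linkVertex hT₀⟩⟩
  obtain ⟨H, hH, rfl⟩ := exists_eq_linkVertex v
  obtain ⟨K, hK, rfl⟩ := exists_eq_linkVertex w
  obtain ⟨T, hT, hHT⟩ := exists_reachable_standard heX hX.2 hS hcard hH
  obtain ⟨T', hT', hKT'⟩ := exists_reachable_standard heX hX.2 hS hcard hK
  exact hHT.trans ((reachable_spanOn hX hS hcard' hT hT').trans hKT'.symm)
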